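/- Let $q$ be a prime number. For a field $K$ put $G:=(K^\times)^q$, $T:=G+1=\{g+1: g\in G\}$, and consider the families of subsets of $K$ \[ \mathcal N_G:=\Big\{\bigcap_{i=1}^n a_i\cdot T:\ n\in\mathbb N,\ a_1,\dots,a_n\in K^\times\Big\},\qquad \mathcal N_G':=\big\{(a_1\cdot T)\cap(a_2\cdot T):\ a_1,a_2\in K^\times\big\}. \] For a family $\mathcal N$ of subsets of $K$ consider the conditions (V3)$'$ there is $V\in\mathcal N$ with $V-V\subseteq T$; (V4)$'$ there is $V\in\mathcal N$ with $V\cdot V\subseteq T$; (V6)$'$ there is $V\in\mathcal N$ such that for all $x,y\in K$, if $x\cdot y\in V$ then $x\in T$ or $y\in T$. A field is called NIP if, as a structure in the language of rings, no formula $\varphi(\bar x;\bar y)$ has the independence property in it; that is, for every $\varphi$ there is $n$ for which there are no tuples $\bar a_i$ ($i<n$) and $\bar b_S$ ($S\subseteq\{0,\dots,n-1\}$) such that $\varphi(\bar a_i;\bar b_S)$ holds if and only if $i\in S$. There are first-order sentences $\psi_3,\psi_4,\psi_6$ in the language of rings, depending only on $q$, such that the following holds. 1. For every field $K$ and each $i\in\{3,4,6\}$,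 condition (V$i$)$'$ holds with $\mathcal N=\mathcal N_G'$ if and only if $K\models\psi_i$. 2. Let $K$ be an infinite NIP field with $\sqrt{-1}\in K$, with $\mathrm{char}(K)\neq q$, containing a primitive $q$-th root of unity $\zeta_q$, and such that $G\neq K^\times$ and $[K^\times:G]<\infty$. Then (V3)$'$, (V4)$'$ and (V6)$'$ all hold with $\mathcal N=\mathcal N_G$ if and only if they all hold with $\mathcal N=\mathcal N_G'$; equivalently, if and only if $K\models\psi_K$, where $\psi_K:=\psi_3\wedge\psi_4\wedge\psi_6$. -/

import Mathlib

open scoped Pointwise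

universe u

namespace NIPField

section ModelTheory

open FirstOrder

/-- The partitioned formula `φ(x; y)` has the independence property in `M`: for every `n` there are
tuples `a i` (`i < n`) and `b S` (`S ⊆ {0, …, n - 1}`) in `M` such that `M ⊨ φ(a i; b S)` holds
exactly when `i ∈ S`. -/
def HasIP {L : Language} (M : Type u) [L.Structure M] {α β : Type} (φ : L.Formula (α ⊕ β)) : Prop :=
  ∀ n : ℕ, ∃ (a : Fin n → α → M) (b : Set (Fin n) → β → M),
    ∀ (i : Fin n) (S : Set (Fin n)), φ.Realize (Sum.elim (a i) (b S)) ↔ i ∈ S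

/-- `M` is NIP: no formula `φ(x; y)`, with `x` and `y` finite tuples of variables, has the
independence property in `M`. For each `n`, the condition in `HasIP` is expressed by a first-order
sentence, so this is a property of the complete theory of `M`. -/
def IsNIP (L : Language) (M : Type u) [L.Structure M] : Prop :=
  ∀ (k m : ℕ) (φ : L.Formula (Fin k ⊕ Fin m)), ¬ HasIP M φ

end ModelTheory

section Neighbourhoods

variable {K : Type u} [Field K]

/-- The subgroup `(Kˣ)^q` of `q`-th powers in `Kˣ`. -/
def powerSubgroup (K : Type u) [Field K] (q : ℕ) : Subgroup Kˣ :=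
  (powMonoidHom q : Kˣ →* Kˣ).range

/-- The set `T = G + 1`. -/
def shift (G : Subgroup Kˣ) : Set K :=
  {x | ∃ g ∈ G, x = (g : K) + 1}

/-- The family `N_G` of all finite intersections of sets `a • (G + 1)`, `a ∈ Kˣ`. -/
def nhdFamily (G : Subgroup Kˣ) : Set (Set K) :=
  {U | ∃ (n : ℕ) (a : Fin n → Kˣ), U = ⋂ i, (a i : K) • shift G}

/-- The family `N_G'` of all intersections `a₁ • (G + 1) ∩ a₂ • (G + 1)`, `a₁, a₂ ∈ Kˣ`. -/
def nhdFamily₂ (G : Subgroup Kˣ) : Set (Set K) :=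
  {U | ∃ a₁ a₂ : Kˣ, U = ((a₁ : K) • shift G) ∩ ((a₂ : K) • shift G)}

/-- `V - V ⊆ T` for some `V` in the family `N`. -/
def CondV3 (G : Subgroup Kˣ) (N : Set (Set K)) : Prop :=
  ∃ V ∈ N, V - V ⊆ shift G

/-- `V * V ⊆ T` for some `V` in the family `N`. -/
def CondV4 (G : Subgroup Kˣ) (N : Set (Set K)) : Prop :=
  ∃ V ∈ N, V * V ⊆ shift G

/-- For some `V` in the family `N`, every product `x * y ∈ V` has a factor in `T`. -/
def CondV6 (G : Subgroup Kˣ) (N : Set (Set K)) : Prop :=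
  ∃ V ∈ N, ∀ x y : K, x * y ∈ V → x ∈ shift G ∨ y ∈ shift G

/-- The conjunction of the three conditions, with witnesses in the family `N`. -/
def CondV346 (G : Subgroup Kˣ) (N : Set (Set K)) : Prop :=
  CondV3 G N ∧ CondV4 G N ∧ CondV6 G N

end Neighbourhoods

end NIPField

namespace NIPField

open FirstOrder FirstOrder.Ring

/-! Each condition over `nhdFamily₂` quantifies over just two units and over `q`-th roots, hence is
first-order. All three conditions survive shrinking `V`, and `nhdFamily₂ G ⊆ nhdFamily G`, so what
remains is to find inside each `U = ⋂ aᵢT` a member of `nhdFamily₂ G`, given (V6)'.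

Take `e ∉ G` and let `⋂ cₘT` witness (V6)'. For a unit `v` lying in suitable dilates of `T`, the set
`vT ∩ veT` works (`exists_mem_nhdFamily₂_subset`): an `x ≠ 0` in it outside `aᵢT` would have `v/x ∈
T ∩ e⁻¹T` by (V6)', and then both `x/v` and `x/(ve)` lie in `G`, so `e ∈ G`.

The unit `v` exists because finitely many translates of `G` meet inside `G`
(`exists_mem_forall_sub_mem`). This is where NIP enters. Amenability of the affine group gives a
finite, almost affine-invariant counting measure on `K`. Finite VC dimension and the packing lemma
make two translates of all cosets of `G` close in measure, and rescaling makes `G` and `G + b` close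
for each prescribed `b`. If the intersection were empty, `G`, then its cosets, then the whole
measure would be too small. -/

/-! ### Almost invariant finite measures, and VC theory -/

/-- A finite multiset of elements of an abelian group, almost invariant under a finite set. -/
theorem exists_almost_invariant {A : Type u} [CommGroup A] (S : Finset A) {η : ℝ} (hη : 0 < η) :
    ∃ (Ω : Type) (_ : Fintype Ω) (_ : Nonempty Ω) (X : Ω → A), ∀ s ∈ S, ∀ f : A → ℝ,
      (∀ x, 0 ≤ f x) → (∀ x, f x ≤ 1) →
      |∑ ω, f (X ω) - ∑ ω, f (s * X ω)| ≤ η * Fintype.card Ω := by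
  classical
  induction S using Finset.induction_on with
  | empty => exact ⟨Unit, inferInstance, inferInstance, fun _ => 1, by simp⟩
  | insert s S hs ih =>
    obtain ⟨Ω, _, _, X, hX⟩ := ih
    obtain ⟨N, hN⟩ := exists_nat_gt (1 / η)
    have hN0 : (0 : ℝ) < N := lt_trans (by positivity) hN
    have hNη : 1 ≤ η * N := by
      rw [div_lt_iff₀ hη] at hN; linarith
    have : NeZero N := ⟨by rintro rfl; simp at hN0⟩
    -- Spreading along `1, s, …, s ^ (N - 1)` makes the sum for `s` telescope to two end layers,
    -- which differ by at most `|Ω| ≤ η N |Ω|`.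
    refine ⟨Ω × Fin N, inferInstance, inferInstance, fun p => s ^ (p.2 : ℕ) * X p.1, ?_⟩
    intro t ht f h0 h1
    simp only [Fintype.sum_prod_type_right, Fintype.card_prod, Fintype.card_fin, Nat.cast_mul]
    rcases Finset.mem_insert.1 ht with rfl | ht
    · have key : ∀ n : ℕ, ∑ i ∈ Finset.range n, (∑ ω, f (t ^ i * X ω) -
          ∑ ω, f (t ^ (i + 1) * X ω)) = ∑ ω, f (X ω) - ∑ ω, f (t ^ n * X ω) := by
        intro n
        rw [Finset.sum_range_sub' (fun i => ∑ ω, f (t ^ i * X ω))]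
        simp
      rw [← Finset.sum_sub_distrib]
      have e : ∑ i : Fin N, (∑ ω, f (t ^ (i : ℕ) * X ω) - ∑ ω, f (t * (t ^ (i : ℕ) * X ω))) =
          ∑ ω, f (X ω) - ∑ ω, f (t ^ N * X ω) := by
        rw [← key, ← Fin.sum_univ_eq_sum_range]
        simp only [pow_succ', mul_assoc]
      rw [e, ← Finset.sum_sub_distrib]
      refine (Finset.abs_sum_le_sum_abs _ _).trans ?_
      have : ∑ ω : Ω, |f (X ω) - f (t ^ N * X ω)| ≤ ∑ ω : Ω, (1 : ℝ) := by
        refine Finset.sum_le_sum fun ω _ => ?_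
        rw [abs_le]
        constructor <;> linarith [h0 (X ω), h1 (X ω), h0 (t ^ N * X ω), h1 (t ^ N * X ω)]
      refine this.trans ?_
      simp only [Finset.sum_const, Finset.card_univ, nsmul_eq_mul, mul_one]
      nlinarith [(Nat.cast_nonneg (Fintype.card Ω) : (0 : ℝ) ≤ _)]
    · rw [← Finset.sum_sub_distrib]
      refine (Finset.abs_sum_le_sum_abs _ _).trans ?_
      have : ∑ i : Fin N, |∑ ω, f (s ^ (i : ℕ) * X ω) - ∑ ω, f (t * (s ^ (i : ℕ) * X ω))| ≤
          ∑ i : Fin N, η * Fintype.card Ω := by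
        refine Finset.sum_le_sum fun i _ => ?_
        -- Commutativity lets `t` pass `s ^ i`, so the earlier invariance survives layer by layer.
        have := hX t ht (fun x => f (s ^ (i : ℕ) * x)) (fun _ => h0 _) (fun _ => h1 _)
        simpa only [mul_left_comm] using this
      refine this.trans (le_of_eq ?_)
      simp; ring

/-- A finite multiset of elements of a field, almost invariant under finitely many affine maps. -/
theorem exists_almost_affine_invariant {K : Type u} [Field K] (S : Finset (Kˣ × K)) {η : ℝ}
    (hη : 0 < η) :
    ∃ (Ω : Type) (_ : Fintype Ω) (_ : Nonempty Ω) (X : Ω → K), ∀ p ∈ S, ∀ f : K → ℝ,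
      (∀ x, 0 ≤ f x) → (∀ x, f x ≤ 1) →
      |∑ ω, f (X ω) - ∑ ω, f (p.1 * X ω + p.2)| ≤ η * Fintype.card Ω := by
  classical
  obtain ⟨Ω, _, _, M, hM⟩ := exists_almost_invariant (S.image Prod.fst) (half_pos hη)
  -- The translations are chosen after `M`: adding `p.2` to `p.1 * M ω * y` amounts to adding `p.2 /
  -- (p.1 * M ω)` to `y`.
  obtain ⟨Ω', _, _, Y, hY⟩ := exists_almost_invariant (A := Multiplicative K)
    ((S ×ˢ (Finset.univ : Finset Ω)).image fun r =>
      Multiplicative.ofAdd (r.1.2 / (r.1.1 * M r.2))) (half_pos hη)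
  refine ⟨Ω × Ω', inferInstance, inferInstance, fun r => M r.1 * (Y r.2).toAdd, ?_⟩
  intro p hp f h0 h1
  have e1 : |∑ r : Ω × Ω', f (M r.1 * (Y r.2).toAdd) -
      ∑ r : Ω × Ω', f (p.1 * (M r.1 * (Y r.2).toAdd))| ≤
      η / 2 * Fintype.card Ω * Fintype.card Ω' := by
    rw [Fintype.sum_prod_type_right, Fintype.sum_prod_type_right, ← Finset.sum_sub_distrib]
    refine (Finset.abs_sum_le_sum_abs _ _).trans ?_
    refine (Finset.sum_le_card_nsmul _ _ (η / 2 * Fintype.card Ω) fun ω' _ => ?_).trans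
      (le_of_eq (by simp; ring))
    have := hM p.1 (Finset.mem_image_of_mem _ hp) (fun x => f (x * (Y ω').toAdd))
      (fun _ => h0 _) (fun _ => h1 _)
    simpa [mul_assoc] using this
  have e2 : |∑ r : Ω × Ω', f (p.1 * (M r.1 * (Y r.2).toAdd)) -
      ∑ r : Ω × Ω', f (p.1 * (M r.1 * (Y r.2).toAdd) + p.2)| ≤
      η / 2 * Fintype.card Ω * Fintype.card Ω' := by
    rw [Fintype.sum_prod_type, Fintype.sum_prod_type, ← Finset.sum_sub_distrib]
    refine (Finset.abs_sum_le_sum_abs _ _).trans ?_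
    refine (Finset.sum_le_card_nsmul _ _ (η / 2 * Fintype.card Ω') fun ω _ => ?_).trans
      (le_of_eq (by simp; ring))
    have := hY (Multiplicative.ofAdd (p.2 / (p.1 * M ω)))
      (Finset.mem_image.2 ⟨(p, ω), by simp [hp], rfl⟩)
      (fun x => f (p.1 * (M ω * x.toAdd))) (fun _ => h0 _) (fun _ => h1 _)
    have e : ∀ ω', (p.1 : K) * (M ω * (Y ω').toAdd) + p.2 =
        p.1 * (M ω * (Multiplicative.ofAdd (p.2 / (p.1 * M ω)) * Y ω').toAdd) := by
      intro ω'
      simp only [toAdd_mul, toAdd_ofAdd]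
      field_simp
      ring
    simpa only [e] using this
  have e3 := abs_sub_le (∑ r : Ω × Ω', f (M r.1 * (Y r.2).toAdd))
    (∑ r : Ω × Ω', f (p.1 * (M r.1 * (Y r.2).toAdd)))
    (∑ r : Ω × Ω', f (p.1 * (M r.1 * (Y r.2).toAdd) + p.2))
  refine e3.trans ((add_le_add e1 e2).trans (le_of_eq ?_))
  push_cast [Fintype.card_prod]; ring

/-- Sauer-Shelah for traces on a finite set. -/
theorem card_le_of_injective_trace {Ω ι : Type*} [DecidableEq Ω] [Fintype ι] (A : ι → Finset Ω)
    (P : Finset Ω) (d : ℕ)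
    (hd : ∀ s : Finset Ω, s.card = d → ¬ (Finset.univ.image A).Shatters s)
    (hinj : Function.Injective fun i => A i ∩ P) :
    Fintype.card ι ≤ d * (P.card + 1) ^ d := by
  set B : Finset (Finset Ω) := Finset.univ.image fun i => A i ∩ P with hB
  have h1 : Fintype.card ι = B.card := by
    rw [hB, Finset.card_image_of_injective _ hinj, Finset.card_univ]
  -- A family has at most as many members as the sets it shatters; here these are subsets of `P`
  -- with fewer than `d` elements.
  have h2 : B.shatterer ⊆ (Finset.range d).biUnion fun j => P.powersetCard j := by
    intro s hs
    rw [Finset.mem_shatterer] at hs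
    have hsP : s ⊆ P := by
      obtain ⟨u, hu, hsu⟩ := hs.exists_superset
      obtain ⟨i, -, rfl⟩ := Finset.mem_image.1 hu
      exact hsu.trans Finset.inter_subset_right
    have hsA : (Finset.univ.image A).Shatters s := by
      intro t ht
      obtain ⟨u, hu, hsu⟩ := hs ht
      obtain ⟨i, -, rfl⟩ := Finset.mem_image.1 hu
      refine ⟨A i, Finset.mem_image_of_mem _ (Finset.mem_univ _), ?_⟩
      rw [← hsu, Finset.inter_comm (A i), ← Finset.inter_assoc, Finset.inter_eq_left.2 hsP]
    have hlt : s.card < d := by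
      by_contra! hge
      obtain ⟨t, hts, htc⟩ := Finset.exists_subset_card_eq hge
      exact hd t htc (hsA.mono_right hts)
    simp only [Finset.mem_biUnion, Finset.mem_range, Finset.mem_powersetCard]
    exact ⟨_, hlt, hsP, rfl⟩
  rw [h1]
  refine (Finset.card_le_card_shatterer B).trans ((Finset.card_le_card h2).trans
    (Finset.card_biUnion_le.trans ?_))
  refine (Finset.sum_le_card_nsmul _ _ ((P.card + 1) ^ d) fun j hj => ?_).trans (by simp)
  rw [Finset.card_powersetCard]
  exact (Nat.choose_le_pow _ _).trans ((Nat.pow_le_pow_left (Nat.le_succ _) _).trans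
    (Nat.pow_le_pow_right (Nat.succ_pos _) (Finset.mem_range.1 hj).le))

open scoped symmDiff in
/-- Few points separate most pairs of a well separated family. -/
theorem exists_separating {Ω ι : Type*} [Fintype Ω] [DecidableEq Ω] [Fintype ι] [DecidableEq ι]
    (A : ι → Finset Ω) {ε : ℝ} (hε1 : ε ≤ 1) [Nonempty Ω]
    (hA : ∀ i j, i ≠ j → ε * Fintype.card Ω < (A i ∆ A j).card) (k : ℕ) :
    ∃ P : Finset Ω, P.card ≤ k ∧
      ((Finset.univ.filter fun p : ι × ι => p.1 ≠ p.2 ∧ A p.1 ∩ P = A p.2 ∩ P).card : ℝ) ≤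
        (1 - ε) ^ k * (Fintype.card ι : ℝ) ^ 2 := by
  induction k with
  | zero =>
    refine ⟨∅, by simp, ?_⟩
    have := Finset.card_le_univ
      (Finset.univ.filter fun p : ι × ι => p.1 ≠ p.2 ∧ A p.1 ∩ ∅ = A p.2 ∩ ∅)
    rw [Fintype.card_prod, ← sq] at this
    simpa using (by exact_mod_cast this :
      ((Finset.univ.filter fun p : ι × ι => p.1 ≠ p.2 ∧ A p.1 ∩ ∅ = A p.2 ∩ ∅).card : ℝ) ≤
        (Fintype.card ι : ℝ) ^ 2)
  | succ k ih =>
    obtain ⟨P, hPk, hP⟩ := ih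
    set R := Finset.univ.filter fun p : ι × ι => p.1 ≠ p.2 ∧ A p.1 ∩ P = A p.2 ∩ P with hR
    -- Averaging over points: each unseparated pair differs on more than an `ε` fraction of `Ω`, so
    -- one point separates an `ε` fraction of these pairs.
    obtain ⟨x, -, hx⟩ : ∃ x ∈ (Finset.univ : Finset Ω),
        ε * R.card ≤ ((R.filter fun p => x ∈ A p.1 ∆ A p.2).card : ℝ) := by
      apply Finset.exists_le_of_sum_le Finset.univ_nonempty
      have : ∑ x : Ω, ((R.filter fun p => x ∈ A p.1 ∆ A p.2).card : ℝ) =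
          ∑ p ∈ R, ((A p.1 ∆ A p.2).card : ℝ) := by
        have := Finset.sum_card_bipartiteAbove_eq_sum_card_bipartiteBelow
          (s := (Finset.univ : Finset Ω)) (t := R) (fun x p => x ∈ A p.1 ∆ A p.2)
        simp only [Finset.bipartiteAbove, Finset.bipartiteBelow, Finset.filter_univ_mem] at this
        exact_mod_cast this
      rw [this]
      refine le_trans (le_of_eq ?_) (Finset.card_nsmul_le_sum R _ (ε * Fintype.card Ω) ?_)
      · rw [nsmul_eq_mul, Finset.sum_const, Finset.card_univ, nsmul_eq_mul]; ring
      · intro p hp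
        exact (hA _ _ (Finset.mem_filter.1 hp).2.1).le
    refine ⟨insert x P, (Finset.card_insert_le _ _).trans (by omega), ?_⟩
    have hsub : (Finset.univ.filter fun p : ι × ι => p.1 ≠ p.2 ∧
        A p.1 ∩ insert x P = A p.2 ∩ insert x P) ⊆
        R.filter fun p => ¬ x ∈ A p.1 ∆ A p.2 := by
      intro p hp
      simp only [Finset.mem_filter, Finset.mem_univ, true_and, hR] at hp ⊢
      obtain ⟨hne, heq⟩ := hp
      rw [Finset.ext_iff] at heq
      refine ⟨⟨hne, ?_⟩, ?_⟩
      · ext z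
        have := heq z
        simp only [Finset.mem_inter, Finset.mem_insert] at this ⊢
        tauto
      · have := heq x
        simp only [Finset.mem_inter, Finset.mem_insert, Finset.mem_symmDiff] at this ⊢
        tauto
    have hcard := Finset.card_filter_add_card_filter_not (s := R) (fun p => x ∈ A p.1 ∆ A p.2)
    have hcard' : ((R.filter fun p => x ∈ A p.1 ∆ A p.2).card : ℝ) +
      ((R.filter fun p => ¬ x ∈ A p.1 ∆ A p.2).card : ℝ) = R.card := by exact_mod_cast hcard
    have hle : ((Finset.univ.filter fun p : ι × ι => p.1 ≠ p.2 ∧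
        A p.1 ∩ insert x P = A p.2 ∩ insert x P).card : ℝ) ≤
        ((R.filter fun p => ¬ x ∈ A p.1 ∆ A p.2).card : ℝ) := by
      exact_mod_cast Finset.card_le_card hsub
    calc _ ≤ (1 - ε) * R.card := by linarith
      _ ≤ (1 - ε) * ((1 - ε) ^ k * (Fintype.card ι : ℝ) ^ 2) := by
        gcongr
      _ = _ := by ring

open scoped symmDiff in
/-- Packing lemma: a large family of bounded VC dimension has two close members. -/
theorem exists_close_of_not_shatters (d : ℕ) {ε : ℝ} (hε : 0 < ε) (hε1 : ε < 1) :
    ∃ N : ℕ, ∀ (Ω : Type u) [Fintype Ω] [DecidableEq Ω] [Nonempty Ω] (A : Fin N → Finset Ω),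
      (∀ s : Finset Ω, s.card = d → ¬ (Finset.univ.image A).Shatters s) →
      ∃ i j, i ≠ j ∧ ((A i ∆ A j).card : ℝ) ≤ ε * Fintype.card Ω := by
  have hlim : Filter.Tendsto (fun k : ℕ => (1 - ε) ^ k * ((d * (k + 1) ^ d + 1 : ℕ) : ℝ) ^ 2)
      Filter.atTop (nhds 0) := by
    have h := tendsto_pow_const_mul_const_pow_of_abs_lt_one (2 * d) (r := 1 - ε)
      (by rw [abs_lt]; constructor <;> linarith)
    have h' := ((Filter.tendsto_add_atTop_iff_nat 1).2 h).const_mul (((d : ℝ) + 1) ^ 2 / (1 - ε))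
    rw [mul_zero] at h'
    refine squeeze_zero (fun k => ?_) (fun k => ?_) h'
    · have : 0 ≤ 1 - ε := by linarith
      positivity
    · have h1 : (0 : ℝ) < 1 - ε := by linarith
      have h2 : ((d * (k + 1) ^ d + 1 : ℕ) : ℝ) ≤ (d + 1) * ((k + 1 : ℕ) : ℝ) ^ d := by
        have : (1 : ℝ) ≤ ((k + 1 : ℕ) : ℝ) ^ d := one_le_pow₀ (by simp)
        push_cast at this ⊢
        linarith
      calc _ ≤ (1 - ε) ^ k * ((d + 1) * ((k + 1 : ℕ) : ℝ) ^ d) ^ 2 := by gcongr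
        _ = _ := by
          rw [pow_succ (1 - ε), pow_mul']
          field_simp
  -- Geometric decay beats the polynomial Sauer-Shelah bound: with one set more than that bound,
  -- fewer than one unseparated pair is left, so all traces are distinct.
  obtain ⟨k, hk⟩ := (hlim.eventually (gt_mem_nhds zero_lt_one)).exists
  refine ⟨d * (k + 1) ^ d + 1, fun Ω _ _ _ A hA => ?_⟩
  by_contra! hcon
  obtain ⟨P, hPk, hP⟩ := exists_separating A hε1.le hcon k
  rw [Fintype.card_fin] at hP
  have hzero : (Finset.univ.filter fun p : Fin (d * (k + 1) ^ d + 1) × Fin (d * (k + 1) ^ d + 1) =>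
      p.1 ≠ p.2 ∧ A p.1 ∩ P = A p.2 ∩ P).card = 0 := by
    have := hP.trans_lt hk
    exact Nat.lt_one_iff.1 (by exact_mod_cast this)
  rw [Finset.card_eq_zero, Finset.filter_eq_empty_iff] at hzero
  have := card_le_of_injective_trace A P d hA (fun i j hij => by
    by_contra hne
    exact hzero (Finset.mem_univ (i, j)) ⟨hne, hij⟩)
  rw [Fintype.card_fin] at this
  have h3 : d * (P.card + 1) ^ d ≤ d * (k + 1) ^ d := by gcongr
  omega

/-! ### Translates of a finite index subgroup -/

section Translates

variable {K : Type u} [Field K]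

/-- The image in `K` of a subgroup of `Kˣ`. -/
def valSet (G : Subgroup Kˣ) : Set K := {x | ∃ g ∈ G, x = (g : K)}

theorem val_mem_valSet {G : Subgroup Kˣ} {g : Kˣ} : (g : K) ∈ valSet G ↔ g ∈ G := by
  constructor
  · rintro ⟨h, hh, e⟩
    rwa [Units.ext e]
  · exact fun h => ⟨g, h, rfl⟩

theorem mul_mem_valSet_iff {G : Subgroup Kˣ} {g : Kˣ} (hg : g ∈ G) {x : K} :
    (g : K) * x ∈ valSet G ↔ x ∈ valSet G := by
  rcases eq_or_ne x 0 with rfl | hx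
  · simp
  · lift x to Kˣ using hx.isUnit
    rw [← Units.val_mul, val_mem_valSet, val_mem_valSet, G.mul_mem_cancel_left hg]

/-- Membership of `x` in the coset `cG` does not depend on the representative, so `Quotient.out` can
be traded for a convenient unit. -/
theorem mul_mem_valSet_iff_of_mk_eq {G : Subgroup Kˣ} {c d : Kˣ}
    (h : (c : Kˣ ⧸ G) = (d : Kˣ ⧸ G)) (x : K) :
    ((c⁻¹ : Kˣ) : K) * x ∈ valSet G ↔ ((d⁻¹ : Kˣ) : K) * x ∈ valSet G := by
  have h' : c⁻¹ * d ∈ G := QuotientGroup.eq.1 h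
  rw [← mul_mem_valSet_iff h' (x := ((d⁻¹ : Kˣ) : K) * x), ← mul_assoc, ← Units.val_mul]
  congr! 3
  simp

/-- If the translates of `G` have finite VC dimension, so do the translates of its cosets, taken
together. -/
theorem not_shatters_cosets {G : Subgroup Kˣ} [Fintype (Kˣ ⧸ G)] {n : ℕ}
    (hn : ¬ ∃ (a : Fin n → K) (b : Set (Fin n) → K), ∀ i S, a i - b S ∈ valSet G ↔ i ∈ S)
    {Ω ι : Type*} [DecidableEq Ω] [DecidableEq (Kˣ ⧸ G)] [Fintype ι] (X : Ω → K) (e : ι → K)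
    (A : ι → Finset (Ω × Kˣ ⧸ G))
    (hA : ∀ i p, p ∈ A i ↔ ((p.2.out⁻¹ : Kˣ) : K) * (X p.1 - e i) ∈ valSet G)
    (s : Finset (Ω × Kˣ ⧸ G)) (hs : s.card = n * Fintype.card (Kˣ ⧸ G)) :
    ¬ (Finset.univ.image A).Shatters s := by
  intro hsh
  -- By pigeonhole `n` of the points carry the same coset; dividing by its representative turns
  -- their shattering into one by translates of `G`.
  obtain ⟨c, -, hc⟩ := Finset.exists_le_card_fiber_of_mul_le_card_of_maps_to
    (s := s) (t := (Finset.univ : Finset (Kˣ ⧸ G))) (f := Prod.snd) (n := n)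
    (fun _ _ => Finset.mem_univ _) Finset.univ_nonempty (by rw [hs, Finset.card_univ, mul_comm])
  obtain ⟨u, hu, hun⟩ := Finset.exists_subset_card_eq hc
  have hus : u ⊆ s := hu.trans (Finset.filter_subset _ _)
  have hsu := hsh.mono_right hus
  let w : Fin n ≃ u := (u.equivFinOfCardEq hun).symm
  have key : ∀ S : Set (Fin n), ∃ i : ι, ∀ k, (w k : Ω × Kˣ ⧸ G) ∈ A i ↔ k ∈ S := by
    classical
    intro S
    obtain ⟨v, hv, huv⟩ := hsu (t := u.attach.filter (fun x => w.symm x ∈ S) |>.map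
      (Function.Embedding.subtype _)) (by
        intro x hx
        simp only [Finset.mem_map, Finset.mem_filter] at hx
        obtain ⟨y, -, rfl⟩ := hx
        exact y.2)
    obtain ⟨i, -, rfl⟩ := Finset.mem_image.1 hv
    refine ⟨i, fun k => ?_⟩
    have := Finset.ext_iff.1 huv (w k)
    simpa using this
  choose i hi using key
  refine hn ⟨fun k => ((c.out⁻¹ : Kˣ) : K) * X (w k).1.1,
    fun S => ((c.out⁻¹ : Kˣ) : K) * e (i S), fun k S => ?_⟩
  rw [← hi S k, hA, (Finset.mem_filter.1 (hu (w k).2)).2, mul_sub]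

/-- In an infinite field, a finite index subgroup `G` of `Kˣ` whose translates have finite VC
dimension meets any finite intersection of its translates. -/
theorem exists_mem_forall_sub_mem [Infinite K] (G : Subgroup Kˣ) [G.FiniteIndex] {n : ℕ}
    (hn : ¬ ∃ (a : Fin n → K) (b : Set (Fin n) → K), ∀ i S, a i - b S ∈ valSet G ↔ i ∈ S)
    (B : Finset Kˣ) : ∃ y ∈ valSet G, ∀ b ∈ B, y - (b : K) ∈ valSet G := by
  classical
  by_contra! hcon
  have : Fintype (Kˣ ⧸ G) := Fintype.ofFinite _
  set Q : ℝ := ((Fintype.card (Kˣ ⧸ G) : ℕ) : ℝ) with hQ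
  have hQ1 : 1 ≤ Q := by
    rw [hQ]; exact_mod_cast Fintype.card_pos
  set β : ℝ := ((B.card : ℕ) : ℝ) with hβ
  have hβ0 : 0 ≤ β := by positivity
  -- The factor collects all the error terms below; together with `1 / 4` for the origin they
  -- account for only half of the total mass.
  obtain ⟨ε, hε, hε1, hεe⟩ : ∃ ε : ℝ, 0 < ε ∧ ε < 1 ∧ ε * (1 + Q + Q * β * (Q + 1)) = 1 / 4 := by
    have h1 : 1 ≤ 1 + Q + Q * β * (Q + 1) := by
      have : 0 ≤ Q * β * (Q + 1) := by positivity
      linarith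
    refine ⟨1 / 4 / (1 + Q + Q * β * (Q + 1)), by positivity, ?_, ?_⟩
    · rw [div_lt_one (by linarith)]; linarith
    · field_simp
  -- `N` is independent of the measure, so the affine maps can be listed before the measure is
  -- built.
  obtain ⟨N, hN⟩ := exists_close_of_not_shatters.{u} (n * Fintype.card (Kˣ ⧸ G)) hε hε1
  let e : ℕ ↪ K := Infinite.natEmbedding K
  let S₁ : Finset (Kˣ × K) := Finset.univ.image fun c : Kˣ ⧸ G => (c.out⁻¹, 0)
  let S₂ : Finset (Kˣ × K) := Finset.univ.image fun i : Fin 4 => (1, -e i)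
  -- Scaling by `r i j b` carries the difference `e i - e j` to `b`; the value `1` is only a filler
  -- for `e i = e j`.
  let r (i j : Fin N) (b : Kˣ) : Kˣ :=
    if h : e i - e j ≠ 0 then b * (Units.mk0 _ h)⁻¹ else 1
  let S₃ : Finset (Kˣ × K) := (Finset.univ ×ˢ B).image
    fun p : (Fin N × Fin N) × Kˣ => (r p.1.1 p.1.2 p.2, - (r p.1.1 p.1.2 p.2 * e p.1.2))
  obtain ⟨Ω, _, _, X, hX⟩ := exists_almost_affine_invariant (S₁ ∪ S₂ ∪ S₃) hε
  set ω : ℝ := ((Fintype.card Ω : ℕ) : ℝ) with hω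
  have hω0 : 0 < ω := by rw [hω]; exact_mod_cast Fintype.card_pos
  let F (D : Set K) : Finset Ω := Finset.univ.filter fun t => X t ∈ D
  have hF : ∀ D t, t ∈ F D ↔ X t ∈ D := by simp [F]
  let m (D : Set K) : ℝ := (((F D).card : ℕ) : ℝ)
  have hm : ∀ p ∈ S₁ ∪ S₂ ∪ S₃, ∀ D : Set K,
      |m D - m {x | (p.1 : K) * x + p.2 ∈ D}| ≤ ε * ω := by
    intro p hp D
    have := hX p hp (fun x => if x ∈ D then 1 else 0) (fun x => by split_ifs <;> simp)
      (fun x => by split_ifs <;> simp)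
    simpa [m, F] using this
  -- the origin is light
  have h0 : m {0} ≤ (1 / 4 + ε) * ω := by
    have h1 : ∀ i : Fin 4, m {0} ≤ m {e i} + ε * ω := by
      intro i
      have := hm (1, -e i) (by simp [S₂]) {0}
      have e1 : {x : K | ((1 : Kˣ) : K) * x + -e i ∈ ({0} : Set K)} = {e i} := by
        ext x; simp [← sub_eq_add_neg, sub_eq_zero]
      simp only [e1] at this
      linarith [(abs_le.1 this).2]
    have h2 : ∑ i : Fin 4, m {e i} ≤ ω := by
      have hd : ((Finset.univ : Finset (Fin 4)) : Set (Fin 4)).PairwiseDisjoint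
          fun i : Fin 4 => F {e i} := by
        intro i _ j _ hij
        rw [Function.onFun, Finset.disjoint_left]
        intro t ht ht'
        simp only [hF, Set.mem_singleton_iff] at ht ht'
        exact hij (Fin.ext (e.injective (ht.symm.trans ht')))
      simp only [m, hω]
      rw [← Nat.cast_sum, ← Finset.card_biUnion (fun i hi j hj => hd hi hj)]
      exact_mod_cast Finset.card_le_univ _
    have h3 := Finset.sum_le_sum fun i (_ : i ∈ (Finset.univ : Finset (Fin 4))) => h1 i
    simp only [Finset.sum_add_distrib, Finset.sum_const, Finset.card_univ, Fintype.card_fin,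
      nsmul_eq_mul] at h3
    push_cast at h3
    linarith
  -- the cosets of `G` are not heavier than `G`
  have hcos : ∀ c : Kˣ ⧸ G,
      m {x | ((c.out⁻¹ : Kˣ) : K) * x ∈ valSet G} ≤ m (valSet G) + ε * ω := by
    intro c
    have := hm (c.out⁻¹, 0) (by simp [S₁]) (valSet G)
    simp only [add_zero] at this
    linarith [(abs_le.1 this).1]
  have htot : ω ≤ m {0} + ∑ c : Kˣ ⧸ G, m {x | ((c.out⁻¹ : Kˣ) : K) * x ∈ valSet G} := by
    have hcover : (Finset.univ : Finset Ω) ⊆ F {0} ∪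
        Finset.univ.biUnion fun c : Kˣ ⧸ G => F {x | ((c.out⁻¹ : Kˣ) : K) * x ∈ valSet G} := by
      intro t _
      rw [Finset.mem_union, hF, Finset.mem_biUnion]
      by_cases ht : X t = 0
      · exact Or.inl ht
      · refine Or.inr ⟨(Units.mk0 _ ht : Kˣ), Finset.mem_univ _, ?_⟩
        rw [hF, Set.mem_ofPred_eq, mul_mem_valSet_iff_of_mk_eq (QuotientGroup.out_eq' (Units.mk0 _ ht : Kˣ ⧸ G))]
        exact ⟨1, G.one_mem, by simp [ht]⟩
    have := (Finset.card_le_card hcover).trans (Finset.card_union_le _ _)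
    have := this.trans (Nat.add_le_add_left Finset.card_biUnion_le _)
    rw [Finset.card_univ] at this
    simp only [m, hω]
    exact_mod_cast this
  -- `G` is almost invariant under translations
  let A (i : Fin N) : Finset (Ω × Kˣ ⧸ G) :=
    Finset.univ.filter fun p => ((p.2.out⁻¹ : Kˣ) : K) * (X p.1 - e i) ∈ valSet G
  have hA : ∀ i p, p ∈ A i ↔ ((p.2.out⁻¹ : Kˣ) : K) * (X p.1 - e i) ∈ valSet G := by
    simp [A]
  obtain ⟨i, j, hij, hclose⟩ := hN (Ω × Kˣ ⧸ G) A
    (not_shatters_cosets hn X (fun i : Fin N => e i) A hA)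
  have hne : e i - e j ≠ 0 := sub_ne_zero.2 fun h => hij (Fin.ext (e.injective h))
  have htrans : ∀ b ∈ B, m {x | x ∈ valSet G ∧ x - (b : K) ∉ valSet G} ≤ (ε * Q + ε) * ω := by
    intro b hb
    have hr : r i j b = b * (Units.mk0 _ hne)⁻¹ := by simp only [r, dif_pos hne]
    have h1 := hm (r i j b, -(r i j b * e j)) (by
      refine Finset.mem_union_right _ (Finset.mem_image.2 ⟨((i, j), b), ?_, rfl⟩)
      simp [hb]) {x | x ∈ valSet G ∧ x - (b : K) ∉ valSet G}
    have h2 : m {x | (r i j b : K) * x + -(r i j b * e j) ∈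
        {x | x ∈ valSet G ∧ x - (b : K) ∉ valSet G}} ≤ ε * Q * ω := by
      refine le_trans ?_ (hclose.trans (le_of_eq ?_))
      · simp only [m]
        norm_cast
        -- After the affine change the set lies in `A j \ A i` over the coset of `r⁻¹`. That coset
        -- is not known in advance, which is why `A` records all cosets at once.
        refine Finset.card_le_card_of_injOn
          (fun t => (t, (((r i j b)⁻¹ : Kˣ) : Kˣ ⧸ G))) ?_ (fun _ _ _ _ h => (Prod.ext_iff.1 h).1)
        intro t ht
        rw [Finset.mem_coe, hF, Set.mem_ofPred_eq] at ht
        have hbe : (b : K) = r i j b * (e i - e j) := by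
          rw [hr]; simp [hne]
        have e1 : (r i j b : K) * X t + -(r i j b * e j) = r i j b * (X t - e j) := by ring
        have e2 : (r i j b : K) * X t + -(r i j b * e j) - b = r i j b * (X t - e i) := by
          rw [hbe]; ring
        rw [e1] at ht
        have ht2 : ¬ (r i j b : K) * (X t - e i) ∈ valSet G := by
          rw [← e2, e1]; exact ht.2
        have hc : ∀ x : K, (((((r i j b)⁻¹ : Kˣ) : Kˣ ⧸ G).out⁻¹ : Kˣ) : K) * x ∈ valSet G ↔
            (r i j b : K) * x ∈ valSet G := by
          intro x
          rw [mul_mem_valSet_iff_of_mk_eq (QuotientGroup.out_eq' (((r i j b)⁻¹ : Kˣ) : Kˣ ⧸ G)),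
            inv_inv]
        rw [Finset.mem_coe, Finset.mem_symmDiff]
        right
        simp only [hA, hc]
        exact ⟨ht.1, ht2⟩
      · rw [Fintype.card_prod]; push_cast; ring
    linarith [(abs_le.1 h1).2]
  have hG : m (valSet G) ≤ β * ((ε * Q + ε) * ω) := by
    have hcover : F (valSet G) ⊆
        B.biUnion fun b => F {x | x ∈ valSet G ∧ x - (b : K) ∉ valSet G} := by
      intro t ht
      obtain ⟨b, hb, hb'⟩ := hcon _ ((hF _ _).1 ht)
      exact Finset.mem_biUnion.2 ⟨b, hb, (hF _ _).2 ⟨(hF _ _).1 ht, hb'⟩⟩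
    have h1 := (Finset.card_le_card hcover).trans Finset.card_biUnion_le
    have h2 : m (valSet G) ≤ ∑ b ∈ B, m {x | x ∈ valSet G ∧ x - (b : K) ∉ valSet G} := by
      simp only [m]; exact_mod_cast h1
    refine h2.trans ((Finset.sum_le_sum htrans).trans (le_of_eq ?_))
    simp [hβ]
  have hsum := Finset.sum_le_sum fun c (_ : c ∈ (Finset.univ : Finset (Kˣ ⧸ G))) => hcos c
  rw [Finset.sum_const, Finset.card_univ, nsmul_eq_mul, ← hQ] at hsum
  have hfin : ω ≤ (1 / 4 + ε * (1 + Q + Q * β * (Q + 1))) * ω := by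
    have : Q * m (valSet G) ≤ Q * (β * ((ε * Q + ε) * ω)) := by gcongr
    nlinarith
  rw [hεe] at hfin
  linarith

end Translates

/-! ### First-order definability -/

section Sentences

variable {K : Type u} [Field K]

theorem mem_smul_shift_iff {G : Subgroup Kˣ} {a : Kˣ} {x : K} :
    x ∈ (a : K) • shift G ↔ ∃ g ∈ G, x = a * (g + 1) := by
  simp only [Set.mem_smul_set, shift, Set.mem_ofPred_eq, smul_eq_mul]
  constructor
  · rintro ⟨_, ⟨g, hg, rfl⟩, rfl⟩; exact ⟨g, hg, rfl⟩
  · rintro ⟨g, hg, rfl⟩; exact ⟨_, ⟨g, hg, rfl⟩, rfl⟩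

theorem mem_smul_shift_powerSubgroup_iff {q : ℕ} {a : Kˣ} {x : K} :
    x ∈ (a : K) • shift (powerSubgroup K q) ↔ ∃ h : K, h ≠ 0 ∧ x = a * (h ^ q + 1) := by
  rw [mem_smul_shift_iff]
  constructor
  · rintro ⟨_, ⟨g, rfl⟩, rfl⟩; exact ⟨g, g.ne_zero, by simp⟩
  · rintro ⟨h, h0, rfl⟩; exact ⟨_, ⟨Units.mk0 h h0, rfl⟩, by simp⟩

theorem mem_shift_powerSubgroup_iff {q : ℕ} {x : K} :
    x ∈ shift (powerSubgroup K q) ↔ ∃ h : K, h ≠ 0 ∧ x = h ^ q + 1 := by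
  have := mem_smul_shift_powerSubgroup_iff (K := K) (q := q) (a := 1) (x := x)
  simpa using this

/-- The `n`-th power of a term. -/
def powTerm {α : Type} (t : Language.ring.Term α) : ℕ → Language.ring.Term α
  | 0 => 1
  | n + 1 => powTerm t n * t

@[simp]
theorem realize_powTerm [CompatibleRing K] {α : Type} (t : Language.ring.Term α) (n : ℕ)
    (v : α → K) : (powTerm t n).realize v = t.realize v ^ n := by
  induction n with
  | zero => simp [powTerm]
  | succ n ih => simp [powTerm, ih, pow_succ]

/-- The formula `h ≠ 0 ∧ t = a (h ^ q + 1)`. -/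
def shiftFormula {n : ℕ} (q : ℕ) (a h t : Language.ring.Term (Empty ⊕ Fin n)) :
    Language.ring.BoundedFormula Empty n :=
  ∼(h.bdEqual 0) ⊓ t.bdEqual (a * (powTerm h q + 1))

@[simp]
theorem realize_shiftFormula [CompatibleRing K] {n : ℕ} (q : ℕ)
    (a h t : Language.ring.Term (Empty ⊕ Fin n)) (v : Empty → K) (w : Fin n → K) :
    (shiftFormula q a h t).Realize v w ↔ h.realize (Sum.elim v w) ≠ 0 ∧
      t.realize (Sum.elim v w) =
        a.realize (Sum.elim v w) * (h.realize (Sum.elim v w) ^ q + 1) := by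
  simp [shiftFormula]

/-- The sentence expressing (V3)' over `N_G'`. -/
def sentenceV3 (q : ℕ) : Language.ring.Sentence :=
  ∃' ∃' ((∼((&0 : Language.ring.Term (Empty ⊕ Fin 2)).bdEqual 0) ⊓ ∼((&1).bdEqual 0)) ⊓
    ∀' ∀' ∀' ∀' ∀' ∀' ((shiftFormula q (&0) (&4) (&2) ⊓ shiftFormula q (&1) (&5) (&2) ⊓
      shiftFormula q (&0) (&6) (&3) ⊓ shiftFormula q (&1) (&7) (&3)) ⟹
      ∃' shiftFormula q 1 (&8) (&2 + -(&3))))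

/-- The sentence expressing (V4)' over `N_G'`. -/
def sentenceV4 (q : ℕ) : Language.ring.Sentence :=
  ∃' ∃' ((∼((&0 : Language.ring.Term (Empty ⊕ Fin 2)).bdEqual 0) ⊓ ∼((&1).bdEqual 0)) ⊓
    ∀' ∀' ∀' ∀' ∀' ∀' ((shiftFormula q (&0) (&4) (&2) ⊓ shiftFormula q (&1) (&5) (&2) ⊓
      shiftFormula q (&0) (&6) (&3) ⊓ shiftFormula q (&1) (&7) (&3)) ⟹
      ∃' shiftFormula q 1 (&8) (&2 * &3)))

/-- The sentence expressing (V6)' over `N_G'`. -/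
def sentenceV6 (q : ℕ) : Language.ring.Sentence :=
  ∃' ∃' ((∼((&0 : Language.ring.Term (Empty ⊕ Fin 2)).bdEqual 0) ⊓ ∼((&1).bdEqual 0)) ⊓
    ∀' ∀' ∀' ∀' ((shiftFormula q (&0) (&4) (&2 * &3) ⊓ shiftFormula q (&1) (&5) (&2 * &3)) ⟹
      ((∃' shiftFormula q 1 (&6) (&2)) ⊔ ∃' shiftFormula q 1 (&6) (&3))))

theorem realize_sentenceV3 [CompatibleRing K] (q : ℕ) :
    K ⊨ sentenceV3 q ↔ ∃ a b : K, (a ≠ 0 ∧ b ≠ 0) ∧ ∀ x y h₁ h₂ h₃ h₄ : K,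
      (((h₁ ≠ 0 ∧ x = a * (h₁ ^ q + 1)) ∧ h₂ ≠ 0 ∧ x = b * (h₂ ^ q + 1)) ∧
        h₃ ≠ 0 ∧ y = a * (h₃ ^ q + 1)) ∧ (h₄ ≠ 0 ∧ y = b * (h₄ ^ q + 1)) →
      ∃ h : K, h ≠ 0 ∧ x - y = h ^ q + 1 := by
  simp only [sentenceV3, Language.Sentence.Realize, Language.Formula.Realize,
    Language.BoundedFormula.realize_ex, Language.BoundedFormula.realize_all,
    Language.BoundedFormula.realize_inf, Language.BoundedFormula.realize_imp,
    Language.BoundedFormula.realize_not, Language.BoundedFormula.realize_bdEqual,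
    realize_shiftFormula, realize_zero, realize_one,
    realize_add, realize_neg, one_mul, sub_eq_add_neg]
  rfl

theorem realize_sentenceV4 [CompatibleRing K] (q : ℕ) :
    K ⊨ sentenceV4 q ↔ ∃ a b : K, (a ≠ 0 ∧ b ≠ 0) ∧ ∀ x y h₁ h₂ h₃ h₄ : K,
      (((h₁ ≠ 0 ∧ x = a * (h₁ ^ q + 1)) ∧ h₂ ≠ 0 ∧ x = b * (h₂ ^ q + 1)) ∧
        h₃ ≠ 0 ∧ y = a * (h₃ ^ q + 1)) ∧ (h₄ ≠ 0 ∧ y = b * (h₄ ^ q + 1)) →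
      ∃ h : K, h ≠ 0 ∧ x * y = h ^ q + 1 := by
  simp only [sentenceV4, Language.Sentence.Realize, Language.Formula.Realize,
    Language.BoundedFormula.realize_ex, Language.BoundedFormula.realize_all,
    Language.BoundedFormula.realize_inf, Language.BoundedFormula.realize_imp,
    Language.BoundedFormula.realize_not, Language.BoundedFormula.realize_bdEqual,
    realize_shiftFormula, realize_zero, realize_one,
    realize_mul, one_mul]
  rfl

theorem realize_sentenceV6 [CompatibleRing K] (q : ℕ) :
    K ⊨ sentenceV6 q ↔ ∃ a b : K, (a ≠ 0 ∧ b ≠ 0) ∧ ∀ x y h₁ h₂ : K,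
      ((h₁ ≠ 0 ∧ x * y = a * (h₁ ^ q + 1)) ∧ h₂ ≠ 0 ∧ x * y = b * (h₂ ^ q + 1)) →
      ((∃ h : K, h ≠ 0 ∧ x = h ^ q + 1) ∨ ∃ h : K, h ≠ 0 ∧ y = h ^ q + 1) := by
  simp only [sentenceV6, Language.Sentence.Realize, Language.Formula.Realize,
    Language.BoundedFormula.realize_ex, Language.BoundedFormula.realize_all,
    Language.BoundedFormula.realize_inf, Language.BoundedFormula.realize_imp,
    Language.BoundedFormula.realize_sup,
    Language.BoundedFormula.realize_not, Language.BoundedFormula.realize_bdEqual,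
    realize_shiftFormula, realize_zero, realize_one,
    realize_mul, one_mul]
  rfl

/-- Replacing units by nonzero elements makes every quantifier range over the field. -/
theorem exists_mem_nhdFamily₂_powerSubgroup_iff {q : ℕ} {P : Set K → Prop} :
    (∃ V ∈ nhdFamily₂ (powerSubgroup K q), P V) ↔ ∃ a b : K, (a ≠ 0 ∧ b ≠ 0) ∧
      P {x | (∃ h : K, h ≠ 0 ∧ x = a * (h ^ q + 1)) ∧ ∃ h : K, h ≠ 0 ∧ x = b * (h ^ q + 1)} := by
  have key : ∀ a b : Kˣ, (a : K) • shift (powerSubgroup K q) ∩ (b : K) • shift (powerSubgroup K q) =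
      {x : K | (∃ h : K, h ≠ 0 ∧ x = a * (h ^ q + 1)) ∧
        ∃ h : K, h ≠ 0 ∧ x = b * (h ^ q + 1)} := by
    intro a b
    ext x
    simp only [Set.mem_inter_iff, mem_smul_shift_powerSubgroup_iff, Set.mem_ofPred_eq]
  constructor
  · rintro ⟨_, ⟨a, b, rfl⟩, h⟩
    rw [key] at h
    exact ⟨a, b, ⟨a.ne_zero, b.ne_zero⟩, h⟩
  · rintro ⟨a, b, ⟨ha, hb⟩, h⟩
    refine ⟨_, ⟨Units.mk0 a ha, Units.mk0 b hb, rfl⟩, ?_⟩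
    rw [key]
    exact h

theorem condV3_iff_realize [CompatibleRing K] (q : ℕ) :
    CondV3 (powerSubgroup K q) (nhdFamily₂ (powerSubgroup K q)) ↔ K ⊨ sentenceV3 q := by
  rw [realize_sentenceV3, CondV3, exists_mem_nhdFamily₂_powerSubgroup_iff]
  simp only [Set.subset_def, Set.mem_sub, Set.mem_ofPred_eq, mem_shift_powerSubgroup_iff]
  refine exists_congr fun a => exists_congr fun b => and_congr_right fun _ => ⟨?_, ?_⟩
  · rintro H x y h₁ h₂ h₃ h₄ ⟨⟨⟨e₁, e₂⟩, e₃⟩, e₄⟩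
    exact H _ ⟨x, ⟨⟨h₁, e₁⟩, h₂, e₂⟩, y, ⟨⟨h₃, e₃⟩, h₄, e₄⟩, rfl⟩
  · rintro H _ ⟨x, ⟨⟨h₁, e₁⟩, h₂, e₂⟩, y, ⟨⟨h₃, e₃⟩, h₄, e₄⟩, rfl⟩
    exact H x y h₁ h₂ h₃ h₄ ⟨⟨⟨e₁, e₂⟩, e₃⟩, e₄⟩

theorem condV4_iff_realize [CompatibleRing K] (q : ℕ) :
    CondV4 (powerSubgroup K q) (nhdFamily₂ (powerSubgroup K q)) ↔ K ⊨ sentenceV4 q := by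
  rw [realize_sentenceV4, CondV4, exists_mem_nhdFamily₂_powerSubgroup_iff]
  simp only [Set.subset_def, Set.mem_mul, Set.mem_ofPred_eq, mem_shift_powerSubgroup_iff]
  refine exists_congr fun a => exists_congr fun b => and_congr_right fun _ => ⟨?_, ?_⟩
  · rintro H x y h₁ h₂ h₃ h₄ ⟨⟨⟨e₁, e₂⟩, e₃⟩, e₄⟩
    exact H _ ⟨x, ⟨⟨h₁, e₁⟩, h₂, e₂⟩, y, ⟨⟨h₃, e₃⟩, h₄, e₄⟩, rfl⟩
  · rintro H _ ⟨x, ⟨⟨h₁, e₁⟩, h₂, e₂⟩, y, ⟨⟨h₃, e₃⟩, h₄, e₄⟩, rfl⟩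
    exact H x y h₁ h₂ h₃ h₄ ⟨⟨⟨e₁, e₂⟩, e₃⟩, e₄⟩

theorem condV6_iff_realize [CompatibleRing K] (q : ℕ) :
    CondV6 (powerSubgroup K q) (nhdFamily₂ (powerSubgroup K q)) ↔ K ⊨ sentenceV6 q := by
  rw [realize_sentenceV6, CondV6, exists_mem_nhdFamily₂_powerSubgroup_iff]
  simp only [Set.mem_ofPred_eq, mem_shift_powerSubgroup_iff]
  refine exists_congr fun a => exists_congr fun b => and_congr_right fun _ => ⟨?_, ?_⟩
  · rintro H x y h₁ h₂ ⟨e₁, e₂⟩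
    exact H x y ⟨⟨h₁, e₁⟩, h₂, e₂⟩
  · rintro H x y ⟨⟨h₁, e₁⟩, h₂, e₂⟩
    exact H x y h₁ h₂ ⟨e₁, e₂⟩

/-- In a NIP field the translates of the group of `q`-th powers have finite VC dimension. -/
theorem IsNIP.exists_not_shatter_powerSubgroup [CompatibleRing K] (hK : IsNIP Language.ring K)
    (q : ℕ) : ∃ n : ℕ, ¬ ∃ (a : Fin n → K) (b : Set (Fin n) → K),
      ∀ i S, (∃ g ∈ powerSubgroup K q, a i - b S = g) ↔ i ∈ S := by
  let t (x : Fin 1 ⊕ Fin 1) : Language.ring.Term ((Fin 1 ⊕ Fin 1) ⊕ Fin 1) := .var (.inl x)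
  let h : Language.ring.Term ((Fin 1 ⊕ Fin 1) ⊕ Fin 1) := &0
  let φ : Language.ring.Formula (Fin 1 ⊕ Fin 1) :=
    Language.BoundedFormula.ex (∼(h.bdEqual 0) ⊓ (t (.inl 0) + -(t (.inr 0))).bdEqual (powTerm h q))
  have hφ : ∀ v : Fin 1 ⊕ Fin 1 → K,
      φ.Realize v ↔ ∃ g ∈ powerSubgroup K q, v (.inl 0) - v (.inr 0) = g := by
    intro v
    have : φ.Realize v ↔ ∃ h : K, h ≠ 0 ∧ v (.inl 0) - v (.inr 0) = h ^ q := by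
      simp [φ, t, h, Language.Formula.Realize, sub_eq_add_neg, Fin.snoc]
    rw [this]
    constructor
    · rintro ⟨h, h0, e⟩
      exact ⟨_, ⟨Units.mk0 h h0, rfl⟩, by simpa using e⟩
    · rintro ⟨_, ⟨g, rfl⟩, e⟩
      exact ⟨g, g.ne_zero, by simpa using e⟩
  have hip := hK 1 1 φ
  simp only [HasIP, hφ, Sum.elim_inl, Sum.elim_inr] at hip
  obtain ⟨n, hn⟩ := not_forall.1 hip
  exact ⟨n, fun ⟨a, b, h⟩ => hn ⟨fun i _ => a i, fun S _ => b S, h⟩⟩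

end Sentences

/-! ### Reduction to intersections of two dilates -/

section Topology

variable {K : Type u} [Field K]

theorem mem_smul_shift_iff_mem_valSet {G : Subgroup Kˣ} (a x : Kˣ) :
    (x : K) ∈ (a : K) • shift G ↔ (x : K) / a - 1 ∈ valSet G := by
  rw [mem_smul_shift_iff]
  refine exists_congr fun g => and_congr_right fun _ => ?_
  rw [sub_eq_iff_eq_add, div_eq_iff a.ne_zero, mul_comm]

/-- Finite intersections of the sets `a • (G + 1)` are nontrivial. -/
theorem exists_unit_mem_iInter_smul_shift [Infinite K] (G : Subgroup Kˣ) [G.FiniteIndex]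
    (hneg : -1 ∈ G) {n : ℕ}
    (hn : ¬ ∃ (a : Fin n → K) (b : Set (Fin n) → K), ∀ i S, a i - b S ∈ valSet G ↔ i ∈ S)
    {ι : Type*} [Finite ι] (a : ι → Kˣ) : ∃ v : Kˣ, ∀ i, (v : K) ∈ (a i : K) • shift G := by
  classical
  have := Fintype.ofFinite ι
  -- With `v = y⁻¹` and `y ∈ G`, multiplying `v / a - 1` by `-y` gives `y - a⁻¹`.
  obtain ⟨_, ⟨y, hy, rfl⟩, hyB⟩ :=
    exists_mem_forall_sub_mem G hn (Finset.univ.image fun i => (a i)⁻¹)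
  refine ⟨y⁻¹, fun i => ?_⟩
  rw [mem_smul_shift_iff_mem_valSet, ← mul_mem_valSet_iff hy, ← mul_mem_valSet_iff hneg]
  convert hyB _ (Finset.mem_image_of_mem _ (Finset.mem_univ i)) using 1
  push_cast
  have := y.ne_zero
  have := (a i).ne_zero
  field_simp
  ring

/-- The neighbourhoods in `N_G` contain dilates of `(G + 1) ∩ e • (G + 1)`. -/
theorem exists_mem_nhdFamily₂_subset [Infinite K] (G : Subgroup Kˣ) [G.FiniteIndex]
    (hneg : -1 ∈ G) (hG : G ≠ ⊤) {n : ℕ}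
    (hn : ¬ ∃ (a : Fin n → K) (b : Set (Fin n) → K), ∀ i S, a i - b S ∈ valSet G ↔ i ∈ S)
    (h6 : CondV6 G (nhdFamily G)) {U : Set K} (hU : U ∈ nhdFamily G) :
    ∃ W ∈ nhdFamily₂ G, W ⊆ U := by
  obtain ⟨_, ⟨l, c, rfl⟩, hV⟩ := h6
  obtain ⟨k, a, rfl⟩ := hU
  obtain ⟨e, he⟩ : ∃ e : Kˣ, e ∉ G := by
    by_contra! h
    exact hG ((Subgroup.eq_top_iff' G).2 h)
  let b : Fin 2 → Kˣ := ![1, e⁻¹]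
  have h0 : ∀ d : Kˣ, (0 : K) ∈ (d : K) • shift G := fun d =>
    mem_smul_shift_iff.2 ⟨-1, hneg, by simp⟩
  have hscale : ∀ (d : Kˣ) (x : K), x ∈ (d : K) • shift G ↔ (d : K)⁻¹ * x ∈ shift G :=
    fun d x => Set.mem_smul_set_iff_inv_smul_mem₀ d.ne_zero _ _
  -- This places `v / (a i * b j)` in the (V6)' witness for all `i`, `j`; it factors as `(x / a i) *
  -- (v / (x * b j))`.
  obtain ⟨v, hv⟩ := exists_unit_mem_iInter_smul_shift G hneg hn
    fun p : Fin k × Fin 2 × Fin l => a p.1 * b p.2.1 * c p.2.2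
  refine ⟨_, ⟨v, v * e, rfl⟩, ?_⟩
  rintro x ⟨hx1, hx2⟩
  rw [Set.mem_iInter]
  intro i
  rcases eq_or_ne x 0 with rfl | hx
  · exact h0 _
  by_contra hxi
  have hinv : ∀ j, (v : K) / x ∈ (b j : K) • shift G := by
    intro j
    have h1 : ((a i)⁻¹ * x) * ((b j : K)⁻¹ * (v / x)) ∈ ⋂ i, (c i : K) • shift G := by
      rw [Set.mem_iInter]
      intro m
      have := hv (i, j, m)
      rw [hscale] at this ⊢
      convert this using 1
      push_cast
      have := (a i).ne_zero
      have := (b j).ne_zero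
      have := (c m).ne_zero
      field_simp
    rcases hV _ _ h1 with h | h
    · exact absurd ((hscale _ _).2 (by simpa using h)) hxi
    · exact (hscale _ _).2 h
  lift x to Kˣ using hx.isUnit
  -- With `z = x / (v * d)`, both `z - 1` and `z⁻¹ - 1` lie in `G`, and `z = -(z - 1) / (z⁻¹ - 1)`.
  have hmem : ∀ (d : Kˣ), (x : K) ∈ ((v * d : Kˣ) : K) • shift G →
      (v : K) / x ∈ ((d⁻¹ : Kˣ) : K) • shift G → x / (v * d) ∈ G := by
    intro d h1 h2
    rw [mem_smul_shift_iff_mem_valSet] at h1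
    rw [← Units.val_div_eq_div_val, mem_smul_shift_iff_mem_valSet] at h2
    obtain ⟨g, hg, eg⟩ := h1
    obtain ⟨h, hh, eh⟩ := h2
    have e1 : x / (v * d) = -1 * g * h⁻¹ := by
      rw [eq_mul_inv_iff_mul_eq]
      ext
      push_cast at eg eh ⊢
      rw [← eg, ← eh]
      have := x.ne_zero
      have := v.ne_zero
      have := d.ne_zero
      field_simp
      ring
    rw [e1]
    exact G.mul_mem (G.mul_mem hneg hg) (G.inv_mem hh)
  have g1 := hmem 1 (by simpa using hx1) (by simpa [b] using hinv 0)
  have g2 := hmem e (by simpa using hx2) (by simpa [b] using hinv 1)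
  refine he ?_
  have e2 : e = x / (v * 1) / (x / (v * e)) := by
    rw [mul_one, div_div_div_cancel_left, mul_div_cancel_left]
  rw [e2]
  exact G.div_mem g1 g2

theorem nhdFamily₂_subset_nhdFamily (G : Subgroup Kˣ) : nhdFamily₂ G ⊆ nhdFamily G := by
  rintro _ ⟨a, b, rfl⟩
  refine ⟨2, ![a, b], ?_⟩
  ext x
  simp [Fin.forall_fin_two]

/-- Every condition passes from a witness to any of its subsets. -/
theorem CondV346.of_refine {G : Subgroup Kˣ} {N N' : Set (Set K)} (h : CondV346 G N)
    (hN : ∀ U ∈ N, ∃ W ∈ N', W ⊆ U) : CondV346 G N' := by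
  obtain ⟨⟨U₃, hU₃, h₃⟩, ⟨U₄, hU₄, h₄⟩, ⟨U₆, hU₆, h₆⟩⟩ := h
  obtain ⟨W₃, hW₃, hs₃⟩ := hN _ hU₃
  obtain ⟨W₄, hW₄, hs₄⟩ := hN _ hU₄
  obtain ⟨W₆, hW₆, hs₆⟩ := hN _ hU₆
  exact ⟨⟨W₃, hW₃, (Set.sub_subset_sub hs₃ hs₃).trans h₃⟩,
    ⟨W₄, hW₄, (Set.mul_subset_mul hs₄ hs₄).trans h₄⟩, ⟨W₆, hW₆, fun x y h => h₆ x y (hs₆ h)⟩⟩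

/-- The square root of `-1` matters only for `q = 2`; for odd `q`, `-1` is its own `q`-th power. -/
theorem neg_one_mem_powerSubgroup {q : ℕ} (hq : q.Prime) (h : IsSquare (-1 : K)) :
    -1 ∈ powerSubgroup K q := by
  rcases hq.eq_two_or_odd' with rfl | hodd
  · obtain ⟨r, hr⟩ := h
    have hr0 : r ≠ 0 := by
      rintro rfl
      simp at hr
    refine ⟨Units.mk0 r hr0, ?_⟩
    ext
    simp [sq, hr]
  · exact ⟨-1, by simp [hodd.neg_one_pow]⟩

theorem condV346_nhdFamily_iff [CompatibleRing K] [Infinite K] {q : ℕ} (hq : q.Prime)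
    (hK : IsNIP Language.ring K) (hsq : IsSquare (-1 : K)) (hG : powerSubgroup K q ≠ ⊤)
    (hfin : (powerSubgroup K q).FiniteIndex) :
    CondV346 (powerSubgroup K q) (nhdFamily (powerSubgroup K q)) ↔
      CondV346 (powerSubgroup K q) (nhdFamily₂ (powerSubgroup K q)) := by
  obtain ⟨n, hn⟩ := hK.exists_not_shatter_powerSubgroup q
  exact ⟨fun h => h.of_refine fun U hU =>
      exists_mem_nhdFamily₂_subset _ (neg_one_mem_powerSubgroup hq hsq) hG hn h.2.2 hU,
    fun h => h.of_refine fun U hU => ⟨U, nhdFamily₂_subset_nhdFamily _ hU, subset_rfl⟩⟩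

end Topology

end NIPField

open FirstOrder FirstOrder.Ring NIPField in
theorem mainTheorem11 (q : ℕ) (hq : q.Prime) :
    ∃ ψ₃ ψ₄ ψ₆ : Language.ring.Sentence,
      -- in every field, the three conditions over `N_G'` are expressed by these sentences
      (∀ (K : Type u) [Field K] [CompatibleRing K],
        (CondV3 (powerSubgroup K q) (nhdFamily₂ (powerSubgroup K q)) ↔ K ⊨ ψ₃) ∧
        (CondV4 (powerSubgroup K q) (nhdFamily₂ (powerSubgroup K q)) ↔ K ⊨ ψ₄) ∧
        (CondV6 (powerSubgroup K q) (nhdFamily₂ (powerSubgroup K q)) ↔ K ⊨ ψ₆)) ∧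
      -- in NIP fields, the conditions over `N_G` and over `N_G'` are equivalent
      (∀ (K : Type u) [Field K] [CompatibleRing K] [Infinite K],
        IsNIP Language.ring K →
        IsSquare (-1 : K) →
        ringChar K ≠ q →
        (∃ ζ : K, IsPrimitiveRoot ζ q) →
        powerSubgroup K q ≠ ⊤ →
        (powerSubgroup K q).FiniteIndex →
        (CondV346 (powerSubgroup K q) (nhdFamily (powerSubgroup K q)) ↔
          CondV346 (powerSubgroup K q) (nhdFamily₂ (powerSubgroup K q))) ∧
        (CondV346 (powerSubgroup K q) (nhdFamily (powerSubgroup K q)) ↔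
          K ⊨ ψ₃ ⊓ ψ₄ ⊓ ψ₆)) := by
  refine ⟨sentenceV3 q, sentenceV4 q, sentenceV6 q,
    fun K _ _ => ⟨condV3_iff_realize q, condV4_iff_realize q, condV6_iff_realize q⟩,
    fun K _ _ _ hK hsq _ _ hG hfin => ?_⟩
  have h := condV346_nhdFamily_iff hq hK hsq hG hfin
  refine ⟨h, h.trans ?_⟩
  rw [CondV346, condV3_iff_realize, condV4_iff_realize, condV6_iff_realize]
  simp only [Language.Sentence.Realize, Language.Formula.realize_inf, and_assoc]
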